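/- Consider the one-armed bandit problem with rounds $0,1,\dots,T$: pulling the left arm gives reward $1$ with known probability $p\in[0,1]$ and $0$ otherwise; pulling the right arm gives reward $1$ with probability $\theta$ and $0$ otherwise, where $\theta\in[0,1]$ is unknown and is drawn before the game from a known prior $\mu$ on $[0,1]$ that is not a point mass. Given $\theta$, all rewards are independent. In every round each of the two players, Alice and Bob, pulls an arm, then observes their own reward and the action, but not the reward, of the other player. A pure strategy chooses the next arm as a function of the past actions of both players and of the player's own past rewards; a mixed strategy is a probability distribution over pure strategies. Cooperating players use a pair of mixed strategies that is optimal, i.e. maximizes the expected sum of the total rewards of both players over rounds $0,\dots,T$. Let $g_T=g(\mu,T)$ be the finite-horizon index of the right arm: the infimum of all $p\in[0,1]$ for which always playing left maximizes the expected total reward over rounds $0,\dots,T$ of a single player. Then there is $T_0=T_0(\mu)$ such that for every $T\ge T_0$ there is $\delta=\delta(T)>0$ with the following property: for every $p\in[0,1]$ with $p<g_T+\delta$, an optimal strategy pair exists, and under every optimal strategy pair, with positive probability at least one of the players selects the right arm at least once. -/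

import Mathlib

open MeasureTheory

noncomputable section

/-- The two arms: the predictable left arm `L` and the risky right arm `R`. -/
inductive Arm : Type
  | L : Arm
  | R : Arm
  deriving DecidableEq

instance : Fintype Arm := ⟨{Arm.L, Arm.R}, by intro x; cases x <;> simp⟩

/-- Sequences of reward bits received by one player in the rounds `0, …, T`. -/
abbrev Bits (T : ℕ) : Type := Fin (T + 1) → Bool

/-- Probability that a Bernoulli variable with success probability `q` takes the value `x`. -/
def bern (q : ℝ) (x : Bool) : ℝ := if x then q else 1 - q

/-- Success probability of an arm, when the left arm succeeds with probability `p` and the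
right arm with probability `θ`. -/
def succProb (p θ : ℝ) : Arm → ℝ
  | Arm.L => p
  | Arm.R => θ

/-- Total reward collected along a sequence of reward bits. -/
def sumBits {T : ℕ} (a : Bits T) : ℝ := ∑ t, if a t then (1 : ℝ) else 0

/-- Expectation of `f` when the pure strategy is drawn from the mixed strategy `σ`
(a probability distribution over finitely many pure strategies). -/
def mixedExp {S : Type} [Fintype S] (σ : PMF S) (f : S → ℝ) : ℝ := ∑ s, (σ s).toReal * f s

/-! ### The single player problem -/

/-- Pure strategies of a single player with rounds `0, …, T`: in round `t` the arm is chosen as a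
function of the own past actions and of the bits observed before round `t`. -/
abbrev SoloStrategy (T : ℕ) : Type :=
  (t : Fin (T + 1)) → (Fin t.val → Arm) → (Fin t.val → Bool) → Arm

/-- The arm that a single player pulls in round `t`, if the reward bits are `a`. -/
def soloPlay {T : ℕ} (S : SoloStrategy T) (a : Bits T) (t : Fin (T + 1)) : Arm :=
  S t (fun s => soloPlay S a (s.castLE t.isLt.le)) (fun s => a (s.castLE t.isLt.le))
termination_by t.val
decreasing_by exact s.isLt

/-- Conditional probability, given `θ`, that the reward bits are `a`. -/
def soloPathProb {T : ℕ} (p θ : ℝ) (S : SoloStrategy T) (a : Bits T) : ℝ :=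
  ∏ t, bern (succProb p θ (soloPlay S a t)) (a t)

/-- Expected total reward of a single player under a pure strategy; nature draws `θ` from `μ`. -/
def soloReward {T : ℕ} (p : ℝ) (μ : Measure unitInterval) (S : SoloStrategy T) : ℝ :=
  ∫ θ : unitInterval, ∑ a : Bits T, soloPathProb p (θ : ℝ) S a * sumBits a ∂μ

/-- A mixed strategy is optimal for a single player. -/
def SoloOptimal {T : ℕ} (p : ℝ) (μ : Measure unitInterval) (σ : PMF (SoloStrategy T)) : Prop :=
  ∀ τ : PMF (SoloStrategy T),
    mixedExp τ (soloReward p μ) ≤ mixedExp σ (soloReward p μ)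

/-- The strategy that plays left in every round. -/
def alwaysLeft (T : ℕ) : SoloStrategy T := fun _ _ _ => Arm.L

/-- The finite-horizon index of the right arm: the infimum of the success probabilities `p` of the
left arm for which playing always left is optimal for a single player. -/
def finiteIndex (μ : Measure unitInterval) (T : ℕ) : ℝ :=
  sInf {p : ℝ | p ∈ Set.Icc (0 : ℝ) 1 ∧ SoloOptimal p μ (PMF.pure (alwaysLeft T))}

/-! ### The two player game -/

/-- Pure strategies of one of the two players, Alice or Bob, with rounds `0, …, T`: in round `t`
the arm is chosen as a function of the public history (the past actions of Alice and Bob) and of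
the private history (the bits which that player observed before round `t`). -/
abbrev Strategy (T : ℕ) : Type :=
  (t : Fin (T + 1)) → (Fin t.val → Arm × Arm) → (Fin t.val → Bool) → Arm

/-- The arms that Alice and Bob pull in round `t`, if Alice receives the reward bits `a` and Bob
the reward bits `b`. -/
def play {T : ℕ} (SA SB : Strategy T) (a b : Bits T) (t : Fin (T + 1)) : Arm × Arm :=
  (SA t (fun s => play SA SB a b (s.castLE t.isLt.le)) (fun s => a (s.castLE t.isLt.le)),
   SB t (fun s => play SA SB a b (s.castLE t.isLt.le)) (fun s => b (s.castLE t.isLt.le)))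
termination_by t.val
decreasing_by all_goals exact s.isLt

/-- Conditional probability, given `θ`, that Alice receives the bits `a` and Bob the bits `b`. -/
def pathProb {T : ℕ} (p θ : ℝ) (SA SB : Strategy T) (a b : Bits T) : ℝ :=
  ∏ t, bern (succProb p θ (play SA SB a b t).1) (a t) *
    bern (succProb p θ (play SA SB a b t).2) (b t)

/-- Expectation of a function of the reward bits under a pair of pure strategies; nature draws
`θ` from `μ`. -/
def pairExp {T : ℕ} (p : ℝ) (μ : Measure unitInterval) (SA SB : Strategy T)
    (F : Bits T → Bits T → ℝ) : ℝ :=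
  ∫ θ : unitInterval, ∑ a : Bits T, ∑ b : Bits T, pathProb p (θ : ℝ) SA SB a b * F a b ∂μ

/-- Expected sum of the total rewards of Alice and Bob under a pair of mixed strategies. -/
def totalReward {T : ℕ} (p : ℝ) (μ : Measure unitInterval) (σA σB : PMF (Strategy T)) : ℝ :=
  mixedExp σA fun SA => mixedExp σB fun SB =>
    pairExp p μ SA SB fun a b => sumBits a + sumBits b

/-- A pair of mixed strategies is optimal for cooperating players: it maximizes the expected sum
of their total rewards. -/
def CoopOptimal {T : ℕ} (p : ℝ) (μ : Measure unitInterval) (σA σB : PMF (Strategy T)) : Prop :=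
  ∀ τA τB : PMF (Strategy T), totalReward p μ τA τB ≤ totalReward p μ σA σB

/-- On the path with reward bits `a`, `b`, at least one of the players selects the right arm at
least once. -/
def Explores {T : ℕ} (SA SB : Strategy T) (a b : Bits T) : Prop :=
  ∃ t, (play SA SB a b t).1 = Arm.R ∨ (play SA SB a b t).2 = Arm.R

open Classical in
/-- Probability that at least one of the players explores the right arm. -/
def exploreProb {T : ℕ} (p : ℝ) (μ : Measure unitInterval) (σA σB : PMF (Strategy T)) : ℝ :=
  mixedExp σA fun SA => mixedExp σB fun SB =>
    pairExp p μ SA SB fun a b => if Explores SA SB a b then 1 else 0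

end

/-! Write `m` for the mean of `μ`, `M` for its essential supremum and `g` for the index. Before the
first right pull the rewards do not depend on `θ`, so the probability `W` of ever exploring does not
either, and the first right pull contributes exactly `W * (m - p)` over playing left. Each later
round contributes at most `max (M - p) 0 * W`. This accounting is `soloReward_eq_explore` and
`laterGain_le`.

Since `μ` is not a point mass, `m < M`. For long horizons `g` lies above the midpoint of `m` and `M`
(`exists_threshold`, `exists_forall_le_finiteIndex`), so that `M - g < g - m`. At `p = g` some
exploring strategy of a single player is no worse than always left (`exists_exploring_at_index`).
Its first pull is a loss that the last round alone cannot recover, so in some round `u < T` the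
right pulls that follow an earlier exploration have positive expected excess.

Let Alice use this strategy. Bob cannot see her rewards, but the event behind that positive excess
is visible in her actions. By pulling right in round `u + 1` exactly on this event, Bob earns the
same positive excess, while Alice loses nothing. Hence the pair strictly beats the all-left total at
`g` (`exists_pairExp_gt_at_index`), and by continuity in `p` also slightly above `g`. Below `g` one
exploring player suffices. A pair that explores with probability zero earns at most the all-left
total (`totalReward_le_of_exploreProb_nonpos`), so it is never optimal. -/

noncomputable section

/-! ### Sums over bit sequences with predictable success probabilities -/

/-- Probability of the bits `a`, if the bit of round `t` is a success with probability `q t a`. -/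
def pathWeight {T : ℕ} (q : Fin (T + 1) → Bits T → ℝ) (a : Bits T) : ℝ := ∏ t, bern (q t a) (a t)

/-- Replacing the success probabilities from round `k` on by `1 / 2`. -/
def cutAt {T : ℕ} (k : ℕ) (q : Fin (T + 1) → Bits T → ℝ) : Fin (T + 1) → Bits T → ℝ :=
  fun t a => if t.val < k then q t a else 1 / 2

theorem bern_half (x : Bool) : bern (1 / 2) x = 1 / 2 := by
  cases x <;> norm_num [bern]

theorem bern_nonneg {q : ℝ} (h0 : 0 ≤ q) (h1 : q ≤ 1) (x : Bool) : 0 ≤ bern q x := by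
  cases x <;> simp [bern, h0, h1]

/-- Pair each `a` with the sequence that has bit `t` flipped: the two factors `bern` add up to `1`,
whatever `q` is. -/
theorem sum_mul_bern {T : ℕ} (t : Fin (T + 1)) (G q : Bits T → ℝ)
    (hG : DependsOn G {t}ᶜ) (hq : DependsOn q {t}ᶜ) :
    ∑ a, G a * bern (q a) (a t) = ∑ a, G a * (1 / 2) := by
  have hinv : Function.Involutive (fun a : Bits T => Function.update a t (!a t)) := by
    intro a; simp
  have hflip : ∀ a : Bits T, ∀ s ∈ ({t}ᶜ : Set (Fin (T + 1))),
      Function.update a t (!a t) s = a s := by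
    intro a s hs
    exact Function.update_of_ne (by simpa using hs) _ _
  have h1 := Equiv.sum_comp hinv.toPerm (fun a => G a * bern (q a) (a t))
  have h2 : ∑ a, G a * bern (q a) (a t) + ∑ a, G a * bern (q a) (a t) = ∑ a, G a := by
    conv_lhs => arg 1; rw [← h1]
    rw [← Finset.sum_add_distrib]
    refine Finset.sum_congr rfl fun a _ => ?_
    have e1 := hG (hflip a)
    have e2 := hq (hflip a)
    simp only [Function.Involutive.coe_toPerm, e1, e2, Function.update_self]
    cases a t <;> simp [bern] <;> ring
  rw [← Finset.sum_mul]
  linarith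

theorem pathWeight_eq_mul_erase {T : ℕ} (q : Fin (T + 1) → Bits T → ℝ) (t : Fin (T + 1))
    (a : Bits T) :
    pathWeight q a = (∏ s ∈ Finset.univ.erase t, bern (q s a) (a s)) * bern (q t a) (a t) :=
  (Finset.prod_erase_mul _ _ (Finset.mem_univ t)).symm

theorem dependsOn_prod_cutAt {T : ℕ} {q : Fin (T + 1) → Bits T → ℝ}
    (hq : ∀ t, DependsOn (q t) (Set.Iio t)) (t : Fin (T + 1)) (k : ℕ) (hk : k ≤ t.val + 1) :
    DependsOn (fun a => ∏ s ∈ Finset.univ.erase t, bern (cutAt k q s a) (a s)) {t}ᶜ := by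
  intro a a' h
  refine Finset.prod_congr rfl fun s hs => ?_
  have hst : s ≠ t := Finset.ne_of_mem_erase hs
  rw [h s hst]
  congr 1
  unfold cutAt
  split_ifs with hsk
  · refine hq s fun i hi => h i ?_
    have hi' : i.val < s.val := hi
    intro e
    rw [Set.mem_singleton_iff] at e
    subst e
    omega
  · rfl

/-- Once the later factors are constant, bit `k` occurs only in its own factor: earlier
probabilities and `F` look only at bits before `k`. So `sum_mul_bern` replaces that factor by `1 /
2`. -/
theorem sum_cutAt_succ {T : ℕ} {q : Fin (T + 1) → Bits T → ℝ}
    (hq : ∀ t, DependsOn (q t) (Set.Iio t)) (k : ℕ) {F : Bits T → ℝ}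
    (hF : DependsOn F {s | s.val < k}) :
    ∑ a, pathWeight (cutAt (k + 1) q) a * F a = ∑ a, pathWeight (cutAt k q) a * F a := by
  by_cases hk : k < T + 1
  · set t : Fin (T + 1) := ⟨k, hk⟩ with ht
    have hE : ∀ a, (∏ s ∈ Finset.univ.erase t, bern (cutAt (k + 1) q s a) (a s))
        = ∏ s ∈ Finset.univ.erase t, bern (cutAt k q s a) (a s) := by
      intro a
      refine Finset.prod_congr rfl fun s hs => ?_
      have hst : s.val ≠ k := fun e => Finset.ne_of_mem_erase hs (Fin.ext e)
      have : (s.val < k + 1) ↔ (s.val < k) := by omega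
      simp only [cutAt, this]
    have := sum_mul_bern t
      (fun a => (∏ s ∈ Finset.univ.erase t, bern (cutAt k q s a) (a s)) * F a) (q t)
      (by
        intro a a' h
        have e1 := dependsOn_prod_cutAt hq t k (by simp [ht]) h
        have e2 : F a = F a' := hF fun i hi => h i (by
          intro e
          rw [Set.mem_singleton_iff] at e
          subst e
          simp [ht] at hi)
        simp only at e1 ⊢
        rw [e1, e2])
      (fun a a' h => hq t fun i hi => h i (ne_of_lt hi))
    calc _ = _ := Finset.sum_congr rfl fun a _ => by
            rw [pathWeight_eq_mul_erase _ t, hE, show cutAt (k + 1) q t a = q t a by simp [cutAt, ht],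
              mul_right_comm]
      _ = _ := this
      _ = _ := Finset.sum_congr rfl fun a _ => by
            rw [pathWeight_eq_mul_erase _ t, show cutAt k q t a = 1 / 2 by simp [cutAt, ht],
              bern_half, mul_right_comm]
  · refine Finset.sum_congr rfl fun a _ => ?_
    congr 2
    funext s a
    have h1 : s.val < k + 1 := by omega
    have h2 : s.val < k := by omega
    simp [cutAt, h1, h2]

theorem sum_pathWeight_cutAt {T : ℕ} {q : Fin (T + 1) → Bits T → ℝ}
    (hq : ∀ t, DependsOn (q t) (Set.Iio t)) (k : ℕ) {F : Bits T → ℝ}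
    (hF : DependsOn F {s | s.val < k}) :
    ∑ a, pathWeight q a * F a = ∑ a, pathWeight (cutAt k q) a * F a := by
  have step : ∀ j, ∑ a, pathWeight (cutAt (k + j) q) a * F a
      = ∑ a, pathWeight (cutAt k q) a * F a := by
    intro j
    induction j with
    | zero => rfl
    | succ j ih =>
      rw [← ih, ← add_assoc]
      exact sum_cutAt_succ hq (k + j) fun a a' h => hF fun i hi => h i (by
        simp only [Set.mem_ofPred_eq] at hi ⊢; omega)
  rw [← step (T + 1)]
  refine Finset.sum_congr rfl fun a _ => ?_
  congr 2
  funext s a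
  have h1 : s.val < k + (T + 1) := by omega
  simp [cutAt, h1]

/-- The expectation of a function of the bits before round `k` depends only on the success
probabilities before round `k`, and only where the function does not vanish. -/
theorem sum_pathWeight_congr {T : ℕ} {q q' : Fin (T + 1) → Bits T → ℝ}
    (hq : ∀ t, DependsOn (q t) (Set.Iio t)) (hq' : ∀ t, DependsOn (q' t) (Set.Iio t)) (k : ℕ)
    {F : Bits T → ℝ} (hF : DependsOn F {s | s.val < k})
    (h : ∀ a, F a ≠ 0 → ∀ t : Fin (T + 1), t.val < k → q t a = q' t a) :
    ∑ a, pathWeight q a * F a = ∑ a, pathWeight q' a * F a := by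
  rw [sum_pathWeight_cutAt hq k hF, sum_pathWeight_cutAt hq' k hF]
  refine Finset.sum_congr rfl fun a _ => ?_
  by_cases h0 : F a = 0
  · simp [h0]
  · congr 1
    refine Finset.prod_congr rfl fun t _ => ?_
    unfold cutAt
    split_ifs with ht
    · rw [h a h0 t ht]
    · rfl

theorem sum_pathWeight {T : ℕ} {q : Fin (T + 1) → Bits T → ℝ}
    (hq : ∀ t, DependsOn (q t) (Set.Iio t)) : ∑ a, pathWeight q a = 1 := by
  have h := sum_pathWeight_cutAt hq 0 (F := fun _ => 1) (fun _ _ _ => rfl)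
  simp only [mul_one] at h
  rw [h]
  simp only [pathWeight, cutAt, Nat.not_lt_zero, if_false, bern_half]
  simp

theorem sum_pathWeight_bit {T : ℕ} {q : Fin (T + 1) → Bits T → ℝ}
    (hq : ∀ t, DependsOn (q t) (Set.Iio t)) (t : Fin (T + 1)) :
    ∑ a, pathWeight q a * (if a t then (1 : ℝ) else 0) = ∑ a, pathWeight q a * q t a := by
  rw [sum_pathWeight_cutAt hq (t.val + 1) (F := fun a => if a t then (1 : ℝ) else 0)
      (fun a a' h => by simp only [h t (Nat.lt_succ_self _)]),
    sum_pathWeight_cutAt hq t.val (F := q t) (hq t)]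
  have hE : ∀ a, (∏ s ∈ Finset.univ.erase t, bern (cutAt (t.val + 1) q s a) (a s))
      = ∏ s ∈ Finset.univ.erase t, bern (cutAt t.val q s a) (a s) := by
    intro a
    refine Finset.prod_congr rfl fun s hs => ?_
    have hst : s.val ≠ t.val := fun e => Finset.ne_of_mem_erase hs (Fin.ext e)
    have : (s.val < t.val + 1) ↔ (s.val < t.val) := by omega
    simp only [cutAt, this]
  -- On a success bit `bern q` equals `q`, so the indicator times `bern q` is `q` times `bern 1`;
  -- this allows the flip argument with the constant probability `1`.
  have := sum_mul_bern t
    (fun a => (∏ s ∈ Finset.univ.erase t, bern (cutAt t.val q s a) (a s)) * q t a) (fun _ => 1)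
    (by
      intro a a' h
      have e1 := dependsOn_prod_cutAt hq t t.val (by simp) h
      have e2 : q t a = q t a' := hq t fun i hi => h i (ne_of_lt hi)
      simp only at e1 ⊢
      rw [e1, e2])
    (fun _ _ _ => rfl)
  calc _ = _ := Finset.sum_congr rfl fun a _ => by
          rw [pathWeight_eq_mul_erase _ t, hE, show cutAt (t.val + 1) q t a = q t a by simp [cutAt],
            mul_assoc, mul_assoc]
          congr 1
          cases a t <;> simp [bern]
    _ = _ := this
    _ = _ := Finset.sum_congr rfl fun a _ => by
          rw [pathWeight_eq_mul_erase _ t, show cutAt t.val q t a = 1 / 2 by simp [cutAt],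
            bern_half, mul_right_comm]

theorem sum_pathWeight_sumBits {T : ℕ} {q : Fin (T + 1) → Bits T → ℝ}
    (hq : ∀ t, DependsOn (q t) (Set.Iio t)) :
    ∑ a, pathWeight q a * sumBits a = ∑ a, pathWeight q a * ∑ t, q t a := by
  simp only [sumBits, Finset.mul_sum]
  rw [Finset.sum_comm, Finset.sum_congr rfl fun t _ => sum_pathWeight_bit hq t, Finset.sum_comm]

theorem pathWeight_nonneg {T : ℕ} {q : Fin (T + 1) → Bits T → ℝ} (h0 : ∀ t a, 0 ≤ q t a)
    (h1 : ∀ t a, q t a ≤ 1) (a : Bits T) : 0 ≤ pathWeight q a :=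
  Finset.prod_nonneg fun t _ => bern_nonneg (h0 t a) (h1 t a) _

theorem sumBits_nonneg {T : ℕ} (a : Bits T) : 0 ≤ sumBits a :=
  Finset.sum_nonneg fun t _ => by split_ifs <;> norm_num

/-! ### The single player -/

theorem succProb_eq (p θ : ℝ) (x : Arm) :
    succProb p θ x = p + (θ - p) * (if x = Arm.R then 1 else 0) := by
  cases x <;> simp [succProb]

theorem succProb_mem {p θ : ℝ} (hp : p ∈ Set.Icc (0 : ℝ) 1) (hθ : θ ∈ Set.Icc (0 : ℝ) 1)
    (x : Arm) : succProb p θ x ∈ Set.Icc (0 : ℝ) 1 := by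
  cases x <;> assumption

theorem soloPlay_congr {T : ℕ} (S : SoloStrategy T) {a a' : Bits T} :
    ∀ t : Fin (T + 1), (∀ s < t, a s = a' s) → soloPlay S a t = soloPlay S a' t := by
  intro t
  induction t using WellFoundedLT.induction with
  | ind t ih =>
    intro h
    rw [soloPlay, soloPlay]
    have hlt : ∀ s : Fin t.val, s.castLE t.isLt.le < t := fun s => s.isLt
    congr 1
    · funext s
      exact ih _ (hlt s) fun i hi => h i (hi.trans (hlt s))
    · funext s
      exact h _ (hlt s)

theorem dependsOn_succProb_soloPlay {T : ℕ} (p θ : ℝ) (S : SoloStrategy T) (t : Fin (T + 1)) :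
    DependsOn (fun a => succProb p θ (soloPlay S a t)) (Set.Iio t) := fun a a' h => by
  simp only [soloPlay_congr S t h]

theorem dependsOn_const_prob {T : ℕ} (p : ℝ) (t : Fin (T + 1)) :
    DependsOn (fun _ : Bits T => p) (Set.Iio t) := fun _ _ _ => rfl

/-- Conditional expectation, given `θ`, of a function of the bits of a single player. -/
def soloExp {T : ℕ} (p θ : ℝ) (S : SoloStrategy T) (F : Bits T → ℝ) : ℝ :=
  ∑ a, soloPathProb p θ S a * F a

/-- Expected excess reward over the left arm of a right pull that is made with intensity `F`. -/
def gain {T : ℕ} (p : ℝ) (μ : Measure unitInterval) (S : SoloStrategy T) (F : Bits T → ℝ) : ℝ :=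
  ∫ θ : unitInterval, ((θ : ℝ) - p) * soloExp p θ S F ∂μ

/-- The right arm is pulled in round `t`. -/
def rightInd {T : ℕ} (S : SoloStrategy T) (t : Fin (T + 1)) (a : Bits T) : ℝ :=
  if soloPlay S a t = Arm.R then 1 else 0

theorem sum_soloPathProb {T : ℕ} (p θ : ℝ) (S : SoloStrategy T) :
    ∑ a, soloPathProb p θ S a = 1 :=
  sum_pathWeight (dependsOn_succProb_soloPlay p θ S)

theorem soloPathProb_nonneg {T : ℕ} {p θ : ℝ} (hp : p ∈ Set.Icc (0 : ℝ) 1)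
    (hθ : θ ∈ Set.Icc (0 : ℝ) 1) (S : SoloStrategy T) (a : Bits T) : 0 ≤ soloPathProb p θ S a :=
  Finset.prod_nonneg fun _ _ =>
    bern_nonneg (succProb_mem hp hθ _).1 (succProb_mem hp hθ _).2 _

theorem soloExp_mono {T : ℕ} {p θ : ℝ} (hp : p ∈ Set.Icc (0 : ℝ) 1)
    (hθ : θ ∈ Set.Icc (0 : ℝ) 1) (S : SoloStrategy T) {F G : Bits T → ℝ} (h : ∀ a, F a ≤ G a) :
    soloExp p θ S F ≤ soloExp p θ S G :=
  Finset.sum_le_sum fun a _ => mul_le_mul_of_nonneg_left (h a) (soloPathProb_nonneg hp hθ S a)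

theorem soloExp_nonneg {T : ℕ} {p θ : ℝ} (hp : p ∈ Set.Icc (0 : ℝ) 1)
    (hθ : θ ∈ Set.Icc (0 : ℝ) 1) (S : SoloStrategy T) {F : Bits T → ℝ} (h : ∀ a, 0 ≤ F a) :
    0 ≤ soloExp p θ S F :=
  Finset.sum_nonneg fun a _ => mul_nonneg (soloPathProb_nonneg hp hθ S a) (h a)

theorem continuous_succProb (x : Arm) : Continuous fun y : ℝ × ℝ => succProb y.1 y.2 x := by
  cases x <;> simp only [succProb] <;> fun_prop

theorem Continuous.bern {X : Type*} [TopologicalSpace X] {f : X → ℝ} (hf : Continuous f)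
    (x : Bool) : Continuous fun y => bern (f y) x := by
  cases x <;> simp only [_root_.bern] <;> simp <;> fun_prop

theorem continuous_soloPathProb {T : ℕ} (S : SoloStrategy T) (a : Bits T) :
    Continuous fun y : ℝ × ℝ => soloPathProb y.1 y.2 S a :=
  continuous_finsetProd _ fun _ _ => (continuous_succProb _).bern _

theorem continuous_soloExp {T : ℕ} (S : SoloStrategy T) (F : Bits T → ℝ) :
    Continuous fun y : ℝ × ℝ => soloExp y.1 y.2 S F :=
  continuous_finsetSum _ fun a _ => (continuous_soloPathProb S a).mul continuous_const

theorem continuous_gain_integrand {T : ℕ} (p : ℝ) (S : SoloStrategy T) (F : Bits T → ℝ) :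
    Continuous fun θ : unitInterval => ((θ : ℝ) - p) * soloExp p θ S F := by
  refine (continuous_subtype_val.sub continuous_const).mul ?_
  exact (continuous_soloExp S F).comp (continuous_const.prodMk continuous_subtype_val)

theorem integrable_of_continuous {μ : Measure unitInterval} [IsFiniteMeasure μ]
    {f : unitInterval → ℝ} (hf : Continuous f) : Integrable f μ :=
  hf.integrable_of_hasCompactSupport (HasCompactSupport.of_compactSpace f)

section
variable {T : ℕ} (p : ℝ) (μ : Measure unitInterval) [IsProbabilityMeasure μ] (S : SoloStrategy T)

theorem soloExp_add (θ : ℝ) (F G : Bits T → ℝ) :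
    soloExp p θ S (fun a => F a + G a) = soloExp p θ S F + soloExp p θ S G := by
  simp only [soloExp, mul_add, Finset.sum_add_distrib]

theorem soloExp_sum {ι : Type*} (θ : ℝ) (s : Finset ι) (F : ι → Bits T → ℝ) :
    soloExp p θ S (fun a => ∑ i ∈ s, F i a) = ∑ i ∈ s, soloExp p θ S (F i) := by
  simp only [soloExp, Finset.mul_sum]
  exact Finset.sum_comm

theorem gain_add (F G : Bits T → ℝ) :
    gain p μ S (fun a => F a + G a) = gain p μ S F + gain p μ S G := by
  unfold gain
  rw [← integral_add (integrable_of_continuous (continuous_gain_integrand p S F))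
    (integrable_of_continuous (continuous_gain_integrand p S G))]
  simp only [soloExp_add, mul_add]

theorem gain_sum {ι : Type*} (s : Finset ι) (F : ι → Bits T → ℝ) :
    gain p μ S (fun a => ∑ i ∈ s, F i a) = ∑ i ∈ s, gain p μ S (F i) := by
  unfold gain
  rw [← integral_finsetSum _ fun i _ => integrable_of_continuous (continuous_gain_integrand p S (F i))]
  simp only [soloExp_sum, Finset.mul_sum]

theorem soloExp_sumBits (θ : ℝ) :
    soloExp p θ S sumBits
      = p * (T + 1) + (θ - p) * soloExp p θ S (fun a => ∑ t, rightInd S t a) := by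
  have h := sum_pathWeight_sumBits (dependsOn_succProb_soloPlay p θ S)
  have h1 := sum_soloPathProb p θ S
  calc soloExp p θ S sumBits
      = ∑ a, soloPathProb p θ S a * ∑ t, succProb p θ (soloPlay S a t) := h
    _ = ∑ a, (soloPathProb p θ S a * (p * (T + 1))
          + (θ - p) * (soloPathProb p θ S a * ∑ t, rightInd S t a)) := by
        refine Finset.sum_congr rfl fun a _ => ?_
        simp only [succProb_eq, Finset.sum_add_distrib, ← Finset.mul_sum, rightInd]
        simp
        ring
    _ = _ := by
        rw [Finset.sum_add_distrib, ← Finset.sum_mul, h1, ← Finset.mul_sum, one_mul]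
        rfl

theorem soloReward_eq :
    soloReward p μ S = p * (T + 1) + gain p μ S (fun a => ∑ t, rightInd S t a) := by
  have : ∀ θ : unitInterval, ∑ a : Bits T, soloPathProb p (θ : ℝ) S a * sumBits a
      = p * (T + 1) + ((θ : ℝ) - p) * soloExp p θ S (fun a => ∑ t, rightInd S t a) :=
    fun θ => soloExp_sumBits p S θ
  unfold soloReward gain
  simp only [this]
  rw [integral_add (integrable_const _)
    (integrable_of_continuous (continuous_gain_integrand p S _))]
  simp

/-- The right arm is pulled before round `k`. -/
def ExploredBefore (k : ℕ) (a : Bits T) : Prop := ∃ s : Fin (T + 1), s.val < k ∧ soloPlay S a s = Arm.R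

instance (k : ℕ) : DecidablePred (ExploredBefore S k) := fun a => by
  unfold ExploredBefore; infer_instance

/-- Probability to explore before round `k`; it does not depend on `θ`. -/
def exploreWeight (k : ℕ) : ℝ :=
  ∑ a, pathWeight (fun _ _ => p) a * (if ExploredBefore S k a then 1 else 0)

theorem exploredBefore_congr (k : ℕ) {a a' : Bits T} (h : ∀ s : Fin (T + 1), s.val < k → a s = a' s) :
    ExploredBefore S k a ↔ ExploredBefore S k a' := by
  refine exists_congr fun s => and_congr_right fun hs => ?_
  rw [soloPlay_congr S s fun i hi => h i (lt_trans (show i.val < s.val from hi) hs)]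

/-- Pass to the complement: on a path without exploration before round `k` every pull so far was
left, so its law is the one with constant probability `p`. -/
theorem soloExp_exploredBefore (θ : ℝ) (k : ℕ) :
    soloExp p θ S (fun a => if ExploredBefore S k a then 1 else 0) = exploreWeight p S k := by
  have h := sum_pathWeight_congr (dependsOn_succProb_soloPlay p θ S)
    (dependsOn_const_prob p) k (F := fun a => if ExploredBefore S k a then (0 : ℝ) else 1)
    (fun a a' h => by simp only [exploredBefore_congr S k h])
    (by
      intro a ha t ht
      have hn : ¬ ExploredBefore S k a := fun hE => ha (by simp [hE])
      have : soloPlay S a t ≠ Arm.R := fun e => hn ⟨t, ht, e⟩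
      rw [succProb_eq]
      simp [this])
  have e : ∀ a, (if ExploredBefore S k a then (1 : ℝ) else 0)
      = 1 - (if ExploredBefore S k a then (0 : ℝ) else 1) := fun a => by split_ifs <;> norm_num
  unfold soloExp exploreWeight
  simp only [e, mul_sub, mul_one, Finset.sum_sub_distrib]
  rw [sum_soloPathProb, sum_pathWeight (dependsOn_const_prob p)]
  exact congrArg (fun x => 1 - x) h

/-- A path with a right pull has exactly one first right pull; all other right pulls come after an
exploration. -/
theorem sum_rightInd (a : Bits T) :
    ∑ t, rightInd S t a = (if ExploredBefore S (T + 1) a then 1 else 0)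
      + ∑ t, rightInd S t a * (if ExploredBefore S t.val a then 1 else 0) := by
  rw [← sub_eq_iff_eq_add, ← Finset.sum_sub_distrib]
  split_ifs with h
  · have hne : (Finset.univ.filter fun t => soloPlay S a t = Arm.R).Nonempty := by
      obtain ⟨s, -, hs⟩ := h
      exact ⟨s, by simpa using hs⟩
    set t₀ := (Finset.univ.filter fun t => soloPlay S a t = Arm.R).min' hne with ht₀
    have hR : soloPlay S a t₀ = Arm.R := by
      have := Finset.min'_mem _ hne
      simpa using this
    have hmin : ∀ s, soloPlay S a s = Arm.R → t₀ ≤ s := fun s hs =>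
      Finset.min'_le _ _ (by simpa using hs)
    rw [Finset.sum_eq_single t₀]
    · have : ¬ ExploredBefore S t₀.val a := fun ⟨s, hs, hs'⟩ =>
        absurd (hmin s hs') (not_le.mpr hs)
      simp [rightInd, hR, this]
    · intro t _ ht
      by_cases hRt : soloPlay S a t = Arm.R
      · have : ExploredBefore S t.val a :=
          ⟨t₀, lt_of_le_of_ne (hmin t hRt) (fun e => ht (Fin.ext e.symm)), hR⟩
        simp [this]
      · simp [rightInd, hRt]
    · simp
  · refine Finset.sum_eq_zero fun t _ => ?_
    have : soloPlay S a t ≠ Arm.R := fun e => h ⟨t, t.isLt, e⟩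
    simp [rightInd, this]

/-- Expected excess reward of the pull in round `t`, after an earlier exploration. -/
def laterGain (t : Fin (T + 1)) : ℝ :=
  gain p μ S (fun a => rightInd S t a * (if ExploredBefore S t.val a then 1 else 0))

/-- Splits off the first right pull. Whether it ever happens is independent of `θ`, so it is worth
the prior mean minus `p`; information can matter only in the `laterGain` terms. -/
theorem soloReward_eq_explore :
    soloReward p μ S = p * (T + 1)
      + (exploreWeight p S (T + 1) * ((∫ θ : unitInterval, (θ : ℝ) ∂μ) - p)
        + ∑ t, laterGain p μ S t) := by
  rw [soloReward_eq]
  simp only [sum_rightInd]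
  rw [gain_add, gain_sum]
  congr 2
  unfold gain
  simp only [soloExp_exploredBefore]
  rw [integral_mul_const, integral_sub (integrable_of_continuous continuous_subtype_val)
    (integrable_const _)]
  simp [mul_comm]

variable {p μ S}

theorem exploreWeight_nonneg (hp : p ∈ Set.Icc (0 : ℝ) 1) (k : ℕ) : 0 ≤ exploreWeight p S k :=
  Finset.sum_nonneg fun a _ => mul_nonneg
    (pathWeight_nonneg (fun _ _ => hp.1) (fun _ _ => hp.2) a) (by split_ifs <;> norm_num)

theorem exploreWeight_pos (hp : p ∈ Set.Ioo (0 : ℝ) 1) {a : Bits T} {t : Fin (T + 1)}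
    (h : soloPlay S a t = Arm.R) : 0 < exploreWeight p S (T + 1) := by
  have hw : ∀ a : Bits T, 0 < pathWeight (fun _ _ => p) a := fun a =>
    Finset.prod_pos fun t _ => by
      have h0 := hp.1
      have h1 := hp.2
      cases a t <;> simp [bern, h0, h1]
  refine Finset.sum_pos' (fun a _ => mul_nonneg (hw a).le (by split_ifs <;> norm_num))
    ⟨a, Finset.mem_univ _, ?_⟩
  have : ExploredBefore S (T + 1) a := ⟨t, t.isLt, h⟩
  simp [this, hw a]

/-- Such a pull occurs only on exploring paths, and its conditional excess is almost surely at most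
`M - p`. The maximum with `0` covers `M < p`. -/
theorem laterGain_le (hp : p ∈ Set.Icc (0 : ℝ) 1) {M : ℝ} (hM : ∀ᵐ θ : unitInterval ∂μ, (θ : ℝ) ≤ M)
    (t : Fin (T + 1)) : laterGain p μ S t ≤ max (M - p) 0 * exploreWeight p S (T + 1) := by
  have : ∫ _ : unitInterval, max (M - p) 0 * exploreWeight p S (T + 1) ∂μ
      = max (M - p) 0 * exploreWeight p S (T + 1) := by simp
  rw [← this]
  refine integral_mono_ae (integrable_of_continuous (continuous_gain_integrand p S _))
    (integrable_const _) ?_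
  filter_upwards [hM] with θ hθ
  have h0 : 0 ≤ soloExp p θ S
      (fun a => rightInd S t a * (if ExploredBefore S t.val a then 1 else 0)) :=
    soloExp_nonneg hp θ.2 S fun a => by unfold rightInd; split_ifs <;> norm_num
  have h1 : soloExp p θ S
      (fun a => rightInd S t a * (if ExploredBefore S t.val a then 1 else 0))
      ≤ exploreWeight p S (T + 1) := by
    rw [← soloExp_exploredBefore p S θ]
    refine soloExp_mono hp θ.2 S fun a => ?_
    by_cases hE : ExploredBefore S t.val a
    · have : ExploredBefore S (T + 1) a := by
        obtain ⟨s, -, hs⟩ := hE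
        exact ⟨s, s.isLt, hs⟩
      simp only [hE, this, if_true, mul_one, rightInd]
      split_ifs <;> norm_num
    · simp only [hE, if_false, mul_zero]
      split_ifs <;> norm_num
  calc ((θ : ℝ) - p) * _ ≤ max (M - p) 0 * _ :=
        mul_le_mul_of_nonneg_right (le_max_of_le_left (by linarith)) h0
    _ ≤ _ := mul_le_mul_of_nonneg_left h1 (le_max_right _ _)

end

/-! ### Mixed strategies -/

theorem sum_toReal_pmf {S : Type} [Fintype S] (σ : PMF S) : ∑ s, (σ s).toReal = 1 := by
  rw [← ENNReal.toReal_sum fun s _ => σ.apply_ne_top s, ← tsum_fintype (L := .unconditional S), σ.tsum_coe]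
  simp

theorem mixedExp_pure {S : Type} [Fintype S] (s : S) (f : S → ℝ) :
    mixedExp (PMF.pure s) f = f s := by
  classical
  unfold mixedExp
  rw [Finset.sum_eq_single s]
  · simp
  · intro b _ hb
    simp [PMF.pure_apply, hb]
  · simp

theorem mixedExp_le {S : Type} [Fintype S] (σ : PMF S) {f : S → ℝ} {c : ℝ}
    (h : ∀ s, σ s ≠ 0 → f s ≤ c) : mixedExp σ f ≤ c := by
  calc mixedExp σ f ≤ ∑ s, (σ s).toReal * c := Finset.sum_le_sum fun s _ => by
        by_cases hs : σ s = 0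
        · simp [hs]
        · exact mul_le_mul_of_nonneg_left (h s hs) ENNReal.toReal_nonneg
    _ = c := by rw [← Finset.sum_mul, sum_toReal_pmf, one_mul]

theorem mixedExp_nonneg {S : Type} [Fintype S] (σ : PMF S) {f : S → ℝ} (h : ∀ s, 0 ≤ f s) :
    0 ≤ mixedExp σ f :=
  Finset.sum_nonneg fun s _ => mul_nonneg ENNReal.toReal_nonneg (h s)

theorem eq_zero_of_mixedExp_nonpos {S : Type} [Fintype S] {σ : PMF S} {f : S → ℝ}
    (h : ∀ s, 0 ≤ f s) (h0 : mixedExp σ f ≤ 0) {s : S} (hs : σ s ≠ 0) : f s = 0 := by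
  have hz := (Finset.sum_eq_zero_iff_of_nonneg fun s _ =>
    mul_nonneg ENNReal.toReal_nonneg (h s)).1 (le_antisymm h0 (mixedExp_nonneg σ h)) s
      (Finset.mem_univ s)
  rcases mul_eq_zero.1 hz with h1 | h1
  · exact absurd ((ENNReal.toReal_eq_zero_iff _).1 h1) (by simp [hs, σ.apply_ne_top s])
  · exact h1

/-! ### Continuity in the success probability of the left arm -/

theorem continuous_integral_unitInterval {μ : Measure unitInterval} [IsFiniteMeasure μ]
    {f : ℝ × ℝ → ℝ} (hf : Continuous f) :
    Continuous fun p : ℝ => ∫ θ : unitInterval, f (p, θ) ∂μ := by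
  have h := continuous_parametric_integral_of_continuous (μ := μ) (s := Set.univ)
    (f := fun (p : ℝ) (θ : unitInterval) => f (p, θ))
    (by
      refine hf.comp ?_
      exact continuous_fst.prodMk (continuous_subtype_val.comp continuous_snd)) isCompact_univ
  simpa using h

theorem continuous_soloReward {T : ℕ} (μ : Measure unitInterval) [IsFiniteMeasure μ]
    (S : SoloStrategy T) : Continuous fun p => soloReward p μ S :=
  continuous_integral_unitInterval (f := fun y => soloExp y.1 y.2 S sumBits)
    (continuous_soloExp S _)

/-! ### The finite-horizon index -/

theorem soloReward_of_forall_left {T : ℕ} (p : ℝ) (μ : Measure unitInterval)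
    [IsProbabilityMeasure μ] {S : SoloStrategy T} (h : ∀ a t, soloPlay S a t ≠ Arm.R) :
    soloReward p μ S = p * (T + 1) := by
  rw [soloReward_eq]
  simp [rightInd, h, gain, soloExp]

theorem soloPlay_alwaysLeft {T : ℕ} (a : Bits T) (t : Fin (T + 1)) :
    soloPlay (alwaysLeft T) a t = Arm.L := by
  rw [soloPlay]; rfl

theorem soloOptimal_alwaysLeft_iff {T : ℕ} (p : ℝ) (μ : Measure unitInterval)
    [IsProbabilityMeasure μ] :
    SoloOptimal p μ (PMF.pure (alwaysLeft T)) ↔ ∀ S : SoloStrategy T,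
      soloReward p μ S ≤ p * (T + 1) := by
  have h0 : soloReward p μ (alwaysLeft T) = p * (T + 1) :=
    soloReward_of_forall_left p μ fun a t => by simp [soloPlay_alwaysLeft]
  unfold SoloOptimal
  rw [mixedExp_pure, h0]
  exact ⟨fun h S => by simpa [mixedExp_pure] using h (PMF.pure S),
    fun h τ => mixedExp_le τ fun s _ => h s⟩

theorem bddBelow_index_set (μ : Measure unitInterval) (T : ℕ) :
    BddBelow {p : ℝ | p ∈ Set.Icc (0 : ℝ) 1 ∧ SoloOptimal p μ (PMF.pure (alwaysLeft T))} :=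
  ⟨0, fun _ hp => hp.1.1⟩

theorem exists_soloReward_gt {T : ℕ} {p : ℝ} {μ : Measure unitInterval} [IsProbabilityMeasure μ]
    (hp : p ∈ Set.Icc (0 : ℝ) 1) (h : p < finiteIndex μ T) :
    ∃ S : SoloStrategy T, p * (T + 1) < soloReward p μ S := by
  by_contra hc
  push Not at hc
  exact notMem_of_lt_csInf h (bddBelow_index_set μ T) ⟨hp, (soloOptimal_alwaysLeft_iff p μ).2 hc⟩

theorem exists_mem_index_set_lt_one {μ : Measure unitInterval} [IsProbabilityMeasure μ] (T : ℕ)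
    (hm : ∫ θ : unitInterval, (θ : ℝ) ∂μ < 1) :
    ∃ p : ℝ, p < 1 ∧ p ∈ Set.Icc (0 : ℝ) 1 ∧ SoloOptimal p μ (PMF.pure (alwaysLeft T)) := by
  set m := ∫ θ : unitInterval, (θ : ℝ) ∂μ with hm_def
  have hm0 : 0 ≤ m := integral_nonneg fun θ => θ.2.1
  have hT : (0 : ℝ) < T + 2 := by positivity
  have hp1 : (m + T + 1) / (T + 2) < 1 := by rw [div_lt_one hT]; linarith
  have hp : (m + T + 1) / (T + 2) ∈ Set.Icc (0 : ℝ) 1 := ⟨by positivity, hp1.le⟩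
  -- This is the break-even point `p - m = (T + 1) * (1 - p)`: the loss of the first pull equals the
  -- bound `1 - p` for the later gain, taken over all `T + 1` rounds.
  refine ⟨(m + T + 1) / (T + 2), hp1, hp, (soloOptimal_alwaysLeft_iff _ μ).2 fun S => ?_⟩
  have hpe : (m + T + 1) / (T + 2) * (T + 2) = m + T + 1 := div_mul_cancel₀ _ hT.ne'
  set p := (m + T + 1) / (T + 2)
  rw [soloReward_eq_explore, ← hm_def]
  have hle : ∑ t, laterGain p μ S t ≤ ∑ _t : Fin (T + 1), (1 - p) * exploreWeight p S (T + 1) :=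
    Finset.sum_le_sum fun t _ => by
      have := laterGain_le (μ := μ) (S := S) hp (M := 1) (Filter.Eventually.of_forall fun θ => θ.2.2) t
      rwa [max_eq_left (by linarith)] at this
  have he := exploreWeight_nonneg (S := S) hp (T + 1)
  simp only [Finset.sum_const, Finset.card_univ, Fintype.card_fin, nsmul_eq_mul] at hle
  push_cast at hle
  have : exploreWeight p S (T + 1) * (m - p) + (T + 1) * ((1 - p) * exploreWeight p S (T + 1))
      = exploreWeight p S (T + 1) * (m + T + 1 - p * (T + 2)) := by ring
  rw [hpe, sub_self, mul_zero] at this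
  linarith

theorem finiteIndex_lt_one {μ : Measure unitInterval} [IsProbabilityMeasure μ] (T : ℕ)
    (hm : ∫ θ : unitInterval, (θ : ℝ) ∂μ < 1) : finiteIndex μ T < 1 := by
  obtain ⟨p, hp1, hp⟩ := exists_mem_index_set_lt_one (μ := μ) T hm
  exact (csInf_le (bddBelow_index_set μ T) hp).trans_lt hp1

/-- Otherwise each strategy either never explores, and ties with always left for all `p`, or is
strictly worse at the index and, by continuity, nearby. As there are finitely many strategies,
always left would be optimal slightly below the index. -/
theorem exists_exploring_at_index {T : ℕ} {μ : Measure unitInterval} [IsProbabilityMeasure μ]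
    (h0 : 0 < finiteIndex μ T) (h1 : finiteIndex μ T < 1) :
    ∃ S : SoloStrategy T, finiteIndex μ T * (T + 1) ≤ soloReward (finiteIndex μ T) μ S ∧
      ∃ a t, soloPlay S a t = Arm.R := by
  by_contra hc
  push Not at hc
  have hev : ∀ S : SoloStrategy T, ∀ᶠ p in nhds (finiteIndex μ T),
      soloReward p μ S ≤ p * (T + 1) := by
    intro S
    rcases le_or_gt (finiteIndex μ T * (T + 1)) (soloReward (finiteIndex μ T) μ S) with h | h
    · exact Filter.Eventually.of_forall fun p => (soloReward_of_forall_left p μ (hc S h)).le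
    · have := (continuous_soloReward μ S).continuousAt.eventually_lt
        (continuous_id.mul continuous_const).continuousAt h
      exact this.mono fun p hp => hp.le
  have hall := (Filter.eventually_all.2 hev).filter_mono
    (nhdsWithin_le_nhds (s := Set.Iio (finiteIndex μ T)))
  have hpos := (lt_mem_nhds h0).filter_mono
    (nhdsWithin_le_nhds (s := Set.Iio (finiteIndex μ T)))
  obtain ⟨p, ⟨hp, hp0⟩, hlt⟩ := ((hall.and hpos).and self_mem_nhdsWithin).exists
  obtain ⟨S, hS⟩ := exists_soloReward_gt (μ := μ) (T := T) ⟨hp0.le, (lt_trans hlt h1).le⟩ hlt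
  exact absurd (hp S) (not_le.2 hS)

/-! ### The index is close to the essential supremum for long horizons -/

/-- Play right for `N` rounds, and continue to do so if and only if all of these succeeded. -/
def trialStrategy (T N : ℕ) : SoloStrategy T := fun t _ x =>
  if N ≤ t.val ∧ ∃ s : Fin t.val, s.val < N ∧ x s = false then Arm.L else Arm.R

/-- The first `N` bits are successes. -/
def trialSuccess {T : ℕ} (N : ℕ) (a : Bits T) : ℝ :=
  ∏ s : Fin (T + 1), if s.val < N then (if a s then 1 else 0) else 1

theorem trialSuccess_eq {T : ℕ} (N : ℕ) (a : Bits T) :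
    trialSuccess N a = if ∃ s : Fin (T + 1), s.val < N ∧ a s = false then 0 else 1 := by
  unfold trialSuccess
  split_ifs with h
  · obtain ⟨s, hs, ha⟩ := h
    exact Finset.prod_eq_zero (Finset.mem_univ s) (by simp [hs, ha])
  · push Not at h
    refine Finset.prod_eq_one fun s _ => ?_
    by_cases hs : s.val < N
    · simp [hs, h s hs]
    · simp [hs]

theorem rightInd_trialStrategy {T N : ℕ} (t : Fin (T + 1)) (a : Bits T) :
    rightInd (trialStrategy T N) t a = if t.val < N then 1 else trialSuccess N a := by
  have hp : soloPlay (trialStrategy T N) a t = if N ≤ t.val ∧ ∃ s : Fin t.val, s.val < N ∧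
      a (s.castLE t.isLt.le) = false then Arm.L else Arm.R := by
    rw [soloPlay]; rfl
  unfold rightInd
  rw [hp]
  by_cases ht : t.val < N
  · simp [ht]
  · have hiff : (∃ s : Fin t.val, s.val < N ∧ a (s.castLE t.isLt.le) = false)
        ↔ ∃ s : Fin (T + 1), s.val < N ∧ a s = false := by
      constructor
      · rintro ⟨s, hs, ha⟩
        exact ⟨s.castLE t.isLt.le, hs, ha⟩
      · rintro ⟨s, hs, ha⟩
        exact ⟨⟨s.val, by omega⟩, hs, ha⟩
    rw [trialSuccess_eq]
    simp only [hiff, not_lt.1 ht, true_and, ht, if_false]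
    split_ifs <;> simp_all

/-- The first `N` pulls are right, so the law may be replaced by independent bits with probability
`θ`, and the sum factorizes over the rounds. -/
theorem soloExp_trialSuccess {T N : ℕ} (hN : N ≤ T + 1) (p θ : ℝ) :
    soloExp p θ (trialStrategy T N) (trialSuccess N) = θ ^ N := by
  have h := sum_pathWeight_congr (dependsOn_succProb_soloPlay p θ (trialStrategy T N))
    (dependsOn_const_prob θ) N (F := trialSuccess N)
    (fun a a' h => Finset.prod_congr rfl fun s _ => by
      by_cases hs : s.val < N
      · simp [hs, h s hs]
      · simp [hs])
    (by
      intro a _ t ht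
      have := rightInd_trialStrategy (N := N) t a
      rw [if_pos ht] at this
      rw [succProb_eq]
      unfold rightInd at this
      rw [this]
      ring)
  refine h.trans ?_
  have h2 := Finset.prod_univ_sum (fun _ : Fin (T + 1) => (Finset.univ : Finset Bool))
    (fun s x => bern θ x * if s.val < N then (if x then (1 : ℝ) else 0) else 1)
  rw [Fintype.piFinset_univ] at h2
  simp only [pathWeight, trialSuccess, ← Finset.prod_mul_distrib]
  rw [← h2]
  have h3 : ∀ s : Fin (T + 1), (∑ x : Bool, bern θ x *
      if s.val < N then (if x then (1 : ℝ) else 0) else 1) = if s.val < N then θ else 1 := by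
    intro s
    by_cases hs : s.val < N <;> simp [hs, bern]
  rw [Finset.prod_congr rfl fun s _ => h3 s, Finset.prod_ite]
  simp [Fin.card_filter_val_lt, hN]

/-- The weight `(θ / p) ^ N` favours large `θ`. By Bernoulli's inequality it adds at least `N * (θ -
p) ^ 2 / p` to the integrand above `p`, while below `p` it only shrinks the negative part. So the
integral grows at least linearly in `N`. -/
theorem exists_integral_pos {μ : Measure unitInterval} [IsProbabilityMeasure μ] {p : ℝ}
    (hp : 0 < p) (hμ : μ {θ : unitInterval | p < θ} ≠ 0) :
    ∃ N : ℕ, 0 < ∫ θ : unitInterval, ((θ : ℝ) - p) * (θ : ℝ) ^ N ∂μ := by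
  have hint : ∀ {f : unitInterval → ℝ}, Continuous f → Integrable f μ := integrable_of_continuous
  set A := ∫ θ : unitInterval, ((θ : ℝ) - p) ∂μ
  set B := ∫ θ : unitInterval, max ((θ : ℝ) - p) 0 ^ 2 / p ∂μ with hB_def
  have hB : 0 < B := by
    rw [hB_def, integral_pos_iff_support_of_nonneg (fun θ => by positivity) (hint (by fun_prop))]
    refine (pos_iff_ne_zero.2 hμ).trans_le (measure_mono fun θ hθ => ?_)
    have hθ' : 0 < (θ : ℝ) - p := sub_pos.2 hθ
    have : 0 < max ((θ : ℝ) - p) 0 := lt_max_of_lt_left hθ'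
    exact (by positivity : max ((θ : ℝ) - p) 0 ^ 2 / p ≠ 0)
  obtain ⟨N, hN⟩ := exists_nat_gt (-A / B)
  refine ⟨N, ?_⟩
  have h1 : 0 < A + N * B := by
    rw [div_lt_iff₀ hB] at hN; linarith
  have h2 : A + N * B ≤ ∫ θ : unitInterval, ((θ : ℝ) - p) * ((θ : ℝ) / p) ^ N ∂μ := by
    rw [hB_def, ← integral_const_mul, ← integral_add (hint (by fun_prop)) (hint (by fun_prop))]
    refine integral_mono (hint (by fun_prop)) (hint (by fun_prop)) fun θ => ?_
    have hθ0 : 0 ≤ (θ : ℝ) := θ.2.1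
    simp only
    rcases le_total (θ : ℝ) p with h | h
    · rw [max_eq_right (by linarith), zero_pow two_ne_zero, zero_div, mul_zero, add_zero]
      have : ((θ : ℝ) / p) ^ N ≤ 1 := pow_le_one₀ (by positivity) ((div_le_one hp).2 h)
      nlinarith
    · rw [max_eq_left (by linarith)]
      have hb := one_add_mul_le_pow (a := ((θ : ℝ) - p) / p)
        (by have : 0 ≤ ((θ : ℝ) - p) / p := div_nonneg (by linarith) hp.le
            linarith) N
      have e : 1 + ((θ : ℝ) - p) / p = θ / p := by field_simp; ring
      rw [e] at hb
      calc ((θ : ℝ) - p) + N * (((θ : ℝ) - p) ^ 2 / p)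
          = ((θ : ℝ) - p) * (1 + N * (((θ : ℝ) - p) / p)) := by ring
        _ ≤ _ := mul_le_mul_of_nonneg_left hb (by linarith)
  have h3 : ∫ θ : unitInterval, ((θ : ℝ) - p) * (θ : ℝ) ^ N ∂μ
      = p ^ N * ∫ θ : unitInterval, ((θ : ℝ) - p) * ((θ : ℝ) / p) ^ N ∂μ := by
    rw [← integral_const_mul]
    congr 1
    funext θ
    rw [div_pow]
    field_simp
  rw [h3]
  have := h1.trans_le h2
  positivity

/-- For `p < p₀` the trial strategy loses at most `1` in each of the `N` trial rounds and gains at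
least `c > 0` in every other round. For long horizons it beats always left, with a bound on `T` that
is uniform in `p`. -/
theorem exists_forall_le_finiteIndex {μ : Measure unitInterval} [IsProbabilityMeasure μ] {p₀ : ℝ}
    (hp₀ : 0 < p₀) (hμ : μ {θ : unitInterval | p₀ < θ} ≠ 0)
    (hm : ∫ θ : unitInterval, (θ : ℝ) ∂μ < 1) :
    ∃ T₀ : ℕ, ∀ T, T₀ ≤ T → p₀ ≤ finiteIndex μ T := by
  obtain ⟨N, hN⟩ := exists_integral_pos hp₀ hμ
  set c := ∫ θ : unitInterval, ((θ : ℝ) - p₀) * (θ : ℝ) ^ N ∂μ with hc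
  obtain ⟨K, hK⟩ := exists_nat_gt ((1 + c) * N / c)
  refine ⟨max N K, fun T hT => ?_⟩
  have hNT : N ≤ T + 1 := (le_max_left N K).trans (hT.trans T.le_succ)
  have hKT : (K : ℝ) ≤ T := by exact_mod_cast (le_max_right N K).trans hT
  obtain ⟨p₁, -, hp₁⟩ := exists_mem_index_set_lt_one (μ := μ) T hm
  refine le_csInf ⟨p₁, hp₁⟩ fun p hp => ?_
  by_contra hlt
  push Not at hlt
  have hle := (soloOptimal_alwaysLeft_iff p μ).1 hp.2 (trialStrategy T N)
  rw [soloReward_eq, gain_sum] at hle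
  have hterm : ∀ t : Fin (T + 1), c - (1 + c) * (if t.val < N then 1 else 0)
      ≤ gain p μ (trialStrategy T N) (rightInd (trialStrategy T N) t) := by
    intro t
    have hfun : rightInd (trialStrategy T N) t = fun a => if t.val < N then 1 else trialSuccess N a :=
      funext fun a => rightInd_trialStrategy t a
    rw [hfun]
    unfold gain
    by_cases ht : t.val < N
    · simp only [ht, if_true]
      have h1 : ∀ θ : ℝ, soloExp p θ (trialStrategy T N) (fun _ => 1) = 1 := fun θ => by
        simp [soloExp, sum_soloPathProb]
      simp only [h1, mul_one]
      have : ∫ _ : unitInterval, (-1 : ℝ) ∂μ ≤ ∫ θ : unitInterval, ((θ : ℝ) - p) ∂μ :=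
        integral_mono (integrable_const _) (integrable_of_continuous (by fun_prop))
          fun θ => by have h0 := θ.2.1; have h1 := hp.1.2; simp only; linarith
      simp only [integral_const, probReal_univ, one_smul] at this
      linarith
    · simp only [ht, if_false, mul_zero, sub_zero]
      refine integral_mono (integrable_of_continuous (by fun_prop))
        (integrable_of_continuous (continuous_gain_integrand p _ _)) fun θ => ?_
      have e : soloExp p θ (trialStrategy T N) (fun a => trialSuccess N a) = (θ : ℝ) ^ N :=
        soloExp_trialSuccess hNT p θ
      simp only [e]
      exact mul_le_mul_of_nonneg_right (by linarith) (pow_nonneg θ.2.1 N)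
  have hsum := Finset.sum_le_sum fun t (_ : t ∈ Finset.univ) => hterm t
  rw [Finset.sum_sub_distrib, ← Finset.mul_sum, Finset.sum_boole, Fin.card_filter_val_lt] at hsum
  simp only [Finset.sum_const, Finset.card_univ, Fintype.card_fin, nsmul_eq_mul,
    min_eq_right hNT] at hsum
  push_cast at hsum
  rw [div_lt_iff₀ hN] at hK
  have : (K : ℝ) * c ≤ T * c := mul_le_mul_of_nonneg_right hKT hN.le
  linarith

theorem exists_threshold {μ : Measure unitInterval} [IsProbabilityMeasure μ]
    (hμ : ∀ x : unitInterval, μ ≠ Measure.dirac x) :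
    ∃ M p₀ : ℝ, (∀ᵐ θ : unitInterval ∂μ, (θ : ℝ) ≤ M) ∧ 0 < p₀ ∧ p₀ < M ∧ M ≤ 1 ∧
      μ {θ : unitInterval | p₀ < θ} ≠ 0 ∧ M - p₀ < p₀ - ∫ θ : unitInterval, (θ : ℝ) ∂μ := by
  set m := ∫ θ : unitInterval, (θ : ℝ) ∂μ with hm_def
  set M := essSup (fun θ : unitInterval => (θ : ℝ)) μ with hM_def
  have hbdd : Filter.IsBoundedUnder (· ≤ ·) (ae μ) (fun θ : unitInterval => (θ : ℝ)) :=
    Filter.isBoundedUnder_of ⟨1, fun θ => θ.2.2⟩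
  have hcob : Filter.IsCoboundedUnder (· ≤ ·) (ae μ) (fun θ : unitInterval => (θ : ℝ)) :=
    Filter.IsBoundedUnder.isCoboundedUnder_le (Filter.isBoundedUnder_of ⟨0, fun θ => θ.2.1⟩)
  have hle : ∀ᵐ θ : unitInterval ∂μ, (θ : ℝ) ≤ M := ae_le_essSup hbdd
  have hM1 : M ≤ 1 := essSup_le_of_ae_le 1 (Filter.Eventually.of_forall fun θ => θ.2.2) hcob
  have hint : Integrable (fun θ : unitInterval => (θ : ℝ)) μ :=
    integrable_of_continuous continuous_subtype_val
  have hm0 : 0 ≤ m := integral_nonneg fun θ => θ.2.1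
  have hmM : m < M := by
    by_contra hc
    push Not at hc
    have hI : ∫ θ : unitInterval, (M - (θ : ℝ)) ∂μ ≤ 0 := by
      rw [integral_sub (integrable_const _) hint]
      simpa using hc
    have hnn : 0 ≤ᵐ[μ] fun θ : unitInterval => M - (θ : ℝ) := by
      filter_upwards [hle] with θ hθ using sub_nonneg.2 hθ
    have hz := (integral_eq_zero_iff_of_nonneg_ae hnn ((integrable_const _).sub hint)).1
      (le_antisymm hI (integral_nonneg_of_ae hnn))
    have heq : ∀ᵐ θ : unitInterval ∂μ, M = θ := by
      filter_upwards [hz] with θ hθ using sub_eq_zero.1 hθ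
    obtain ⟨x, hx⟩ := heq.exists
    refine hμ x ?_
    have hid : (id : unitInterval → unitInterval) =ᵐ[μ] fun _ => x := by
      filter_upwards [heq] with θ hθ
      exact Subtype.ext (hθ.symm.trans hx)
    calc μ = μ.map id := Measure.map_id.symm
      _ = μ.map fun _ => x := Measure.map_congr hid
      _ = Measure.dirac x := by rw [Measure.map_const, measure_univ, one_smul]
  -- Any point strictly between the midpoint of `m` and `M` and `M` itself would do.
  refine ⟨M, (m + 3 * M) / 4, hle, by linarith, by linarith, hM1, fun h0 => ?_, by linarith⟩
  have : M ≤ (m + 3 * M) / 4 := essSup_le_of_ae_le _ (by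
    refine (measure_eq_zero_iff_ae_notMem.1 h0).mono fun θ hθ => ?_
    simpa using hθ) hcob
  linarith

/-! ### Two players -/

/-- Alice follows a single player strategy and ignores Bob. -/
def ignoringPartner {T : ℕ} (S : SoloStrategy T) : Strategy T := fun t h x =>
  S t (fun s => (h s).1) x

/-- Bob reacts to the past actions of Alice only. -/
def watching {T : ℕ} (β : (t : Fin (T + 1)) → (Fin t.val → Arm) → Arm) : Strategy T :=
  fun t h _ => β t fun s => (h s).1

/-- The arm that a watching Bob pulls in round `t`, if Alice receives the bits `a`. -/
def response {T : ℕ} (S : SoloStrategy T) (β : (t : Fin (T + 1)) → (Fin t.val → Arm) → Arm)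
    (a : Bits T) (t : Fin (T + 1)) : Arm :=
  β t fun s => soloPlay S a (s.castLE t.isLt.le)

theorem play_watching {T : ℕ} (S : SoloStrategy T)
    (β : (t : Fin (T + 1)) → (Fin t.val → Arm) → Arm) (a b : Bits T) :
    ∀ t, play (ignoringPartner S) (watching β) a b t = (soloPlay S a t, response S β a t) := by
  intro t
  induction t using WellFoundedLT.induction with
  | ind t ih =>
    have hfst : (fun s : Fin t.val =>
        (play (ignoringPartner S) (watching β) a b (s.castLE t.isLt.le)).1)
        = fun s => soloPlay S a (s.castLE t.isLt.le) := by
      funext s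
      rw [ih _ (show s.castLE t.isLt.le < t from s.isLt)]
    rw [play, soloPlay]
    simp only [ignoringPartner, watching, response] at hfst ⊢
    rw [hfst]

/-- Given `θ` and Alice's bits, Bob's arms are fixed and his bits independent. Summing them out
leaves his right pulls valued under Alice's law alone, as if she had made them. -/
theorem pairExp_watching {T : ℕ} (p : ℝ) (μ : Measure unitInterval) [IsProbabilityMeasure μ]
    (S : SoloStrategy T) (β : (t : Fin (T + 1)) → (Fin t.val → Arm) → Arm) :
    pairExp p μ (ignoringPartner S) (watching β) (fun a b => sumBits a + sumBits b)
      = soloReward p μ S + p * (T + 1)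
        + gain p μ S (fun a => ∑ t, if response S β a t = Arm.R then 1 else 0) := by
  have key : ∀ θ : ℝ, ∑ a : Bits T, ∑ b : Bits T,
      pathProb p θ (ignoringPartner S) (watching β) a b * (sumBits a + sumBits b)
      = soloExp p θ S sumBits + p * (T + 1) + (θ - p) * soloExp p θ S
          (fun a => ∑ t, if response S β a t = Arm.R then 1 else 0) := by
    intro θ
    have hb : ∀ a : Bits T, ∑ b : Bits T,
        pathProb p θ (ignoringPartner S) (watching β) a b * (sumBits a + sumBits b)
        = soloPathProb p θ S a * sumBits a + soloPathProb p θ S a * (p * (T + 1))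
          + (θ - p) * (soloPathProb p θ S a * ∑ t, if response S β a t = Arm.R then 1 else 0) := by
      intro a
      have hq : ∀ t : Fin (T + 1),
          DependsOn (fun _ : Bits T => succProb p θ (response S β a t)) (Set.Iio t) :=
        fun _ _ _ _ => rfl
      have h1 := sum_pathWeight hq
      have h2 := sum_pathWeight_sumBits hq
      rw [← Finset.sum_mul, h1, one_mul] at h2
      simp only [succProb_eq p θ (response _ _ _ _), Finset.sum_add_distrib, ← Finset.mul_sum,
        Finset.sum_const, Finset.card_univ, Fintype.card_fin, nsmul_eq_mul] at h2
      have h3 : ∀ b : Bits T, pathProb p θ (ignoringPartner S) (watching β) a b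
          = soloPathProb p θ S a *
            pathWeight (fun t _ => succProb p θ (response S β a t)) b := by
        intro b
        simp only [pathProb, play_watching, Finset.prod_mul_distrib, soloPathProb, pathWeight]
      simp only [h3, mul_assoc, ← Finset.mul_sum, mul_add, Finset.sum_add_distrib]
      simp only [succProb_eq p θ (response _ _ _ _)] at h1 h2 ⊢
      rw [← Finset.sum_mul, h1, h2]
      push_cast
      ring
    rw [Finset.sum_congr rfl fun a _ => hb a, Finset.sum_add_distrib, Finset.sum_add_distrib,
      ← Finset.sum_mul, sum_soloPathProb, one_mul, ← Finset.mul_sum]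
    rfl
  have hc : Continuous fun θ : unitInterval => soloExp p θ S sumBits :=
    (continuous_soloExp S sumBits).comp (continuous_const.prodMk continuous_subtype_val)
  have hc' : Integrable (fun θ : unitInterval => soloExp p θ S sumBits + p * (T + 1)) μ :=
    integrable_of_continuous (hc.add continuous_const)
  unfold pairExp
  simp only [key]
  rw [integral_add hc' (integrable_of_continuous (continuous_gain_integrand p S _)),
    integral_add (integrable_of_continuous hc) (integrable_const _)]
  simp [soloReward, gain, soloExp]

/-! ### Pairs that never explore, and optimal pairs -/

theorem continuous_pathProb {T : ℕ} (SA SB : Strategy T) (a b : Bits T) :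
    Continuous fun y : ℝ × ℝ => pathProb y.1 y.2 SA SB a b :=
  continuous_finsetProd _ fun _ _ =>
    ((continuous_succProb _).bern _).mul ((continuous_succProb _).bern _)

theorem continuous_pair_integrand {T : ℕ} (SA SB : Strategy T) (F : Bits T → Bits T → ℝ) :
    Continuous fun y : ℝ × ℝ => ∑ a : Bits T, ∑ b : Bits T, pathProb y.1 y.2 SA SB a b * F a b :=
  continuous_finsetSum _ fun a _ => continuous_finsetSum _ fun b _ =>
    (continuous_pathProb SA SB a b).mul continuous_const

theorem integrable_pair_integrand {T : ℕ} (p : ℝ) (μ : Measure unitInterval) [IsFiniteMeasure μ]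
    (SA SB : Strategy T) (F : Bits T → Bits T → ℝ) :
    Integrable (fun θ : unitInterval =>
      ∑ a : Bits T, ∑ b : Bits T, pathProb p (θ : ℝ) SA SB a b * F a b) μ := by
  refine integrable_of_continuous (continuous_finsetSum _ fun a _ => continuous_finsetSum _ fun b _ =>
    Continuous.mul ?_ continuous_const)
  exact (continuous_pathProb SA SB a b).comp (continuous_const.prodMk continuous_subtype_val)

theorem continuous_pairExp {T : ℕ} (μ : Measure unitInterval) [IsFiniteMeasure μ]
    (SA SB : Strategy T) (F : Bits T → Bits T → ℝ) : Continuous fun p => pairExp p μ SA SB F :=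
  continuous_integral_unitInterval (continuous_pair_integrand SA SB F)

theorem pathProb_nonneg {T : ℕ} {p θ : ℝ} (hp : p ∈ Set.Icc (0 : ℝ) 1)
    (hθ : θ ∈ Set.Icc (0 : ℝ) 1) (SA SB : Strategy T) (a b : Bits T) :
    0 ≤ pathProb p θ SA SB a b :=
  Finset.prod_nonneg fun _ _ => mul_nonneg
    (bern_nonneg (succProb_mem hp hθ _).1 (succProb_mem hp hθ _).2 _)
    (bern_nonneg (succProb_mem hp hθ _).1 (succProb_mem hp hθ _).2 _)

theorem pathProb_of_not_explores {T : ℕ} {p θ : ℝ} {SA SB : Strategy T} {a b : Bits T}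
    (h : ¬ Explores SA SB a b) :
    pathProb p θ SA SB a b = pathWeight (fun _ _ => p) a * pathWeight (fun _ _ => p) b := by
  unfold Explores at h
  push Not at h
  unfold pathProb pathWeight
  rw [← Finset.prod_mul_distrib]
  refine Finset.prod_congr rfl fun t _ => ?_
  have h1 : (play SA SB a b t).1 = Arm.L := by
    cases e : (play SA SB a b t).1 with
    | L => rfl
    | R => exact absurd e (h t).1
  have h2 : (play SA SB a b t).2 = Arm.L := by
    cases e : (play SA SB a b t).2 with
    | L => rfl
    | R => exact absurd e (h t).2
  rw [h1, h2]
  rfl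

theorem sum_left_sumBits (T : ℕ) (p : ℝ) :
    ∑ a : Bits T, ∑ b : Bits T, pathWeight (fun _ _ => p) a * pathWeight (fun _ _ => p) b
      * (sumBits a + sumBits b) = 2 * (p * (T + 1)) := by
  have h1 := sum_pathWeight (dependsOn_const_prob (T := T) p)
  have h2 := sum_pathWeight_sumBits (dependsOn_const_prob (T := T) p)
  rw [← Finset.sum_mul, h1] at h2
  simp only [Finset.sum_const, Finset.card_univ, Fintype.card_fin, nsmul_eq_mul, one_mul] at h2
  push_cast at h2
  have hb : ∀ a : Bits T, ∑ b : Bits T, pathWeight (fun _ _ => p) a * pathWeight (fun _ _ => p) b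
      * (sumBits a + sumBits b)
      = pathWeight (fun _ _ => p) a * sumBits a
        + pathWeight (fun _ _ => p) a * ((T + 1) * p) := by
    intro a
    simp only [mul_add, mul_assoc, Finset.sum_add_distrib, ← Finset.mul_sum, h2]
    rw [← Finset.sum_mul, h1, one_mul]
  rw [Finset.sum_congr rfl fun a _ => hb a, Finset.sum_add_distrib, h2, ← Finset.sum_mul, h1]
  ring

open Classical in
theorem pairExp_explores_nonneg {T : ℕ} {p : ℝ} (hp : p ∈ Set.Icc (0 : ℝ) 1)
    (μ : Measure unitInterval) (SA SB : Strategy T) :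
    0 ≤ pairExp p μ SA SB fun a b => if Explores SA SB a b then 1 else 0 :=
  integral_nonneg fun θ => Finset.sum_nonneg fun a _ => Finset.sum_nonneg fun b _ =>
    mul_nonneg (pathProb_nonneg hp θ.2 SA SB a b) (by dsimp only; split_ifs <;> norm_num)

-- Exploring paths have probability zero for almost every `θ`, and all other paths have the same
-- probability as under two players who always play left. Rewards are nonnegative, so enlarging the
-- sum to all paths gives the bound.
open Classical in
theorem pairExp_le_of_not_explores {T : ℕ} {p : ℝ} (hp : p ∈ Set.Icc (0 : ℝ) 1)
    {μ : Measure unitInterval} [IsProbabilityMeasure μ] {SA SB : Strategy T}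
    (h : (pairExp p μ SA SB fun a b => if Explores SA SB a b then 1 else 0) = 0) :
    pairExp p μ SA SB (fun a b => sumBits a + sumBits b) ≤ 2 * (p * (T + 1)) := by
  have hterm : ∀ (θ : unitInterval) (a b : Bits T),
      0 ≤ pathProb p θ SA SB a b * (if Explores SA SB a b then (1 : ℝ) else 0) := fun θ a b =>
    mul_nonneg (pathProb_nonneg hp θ.2 SA SB a b) (by split_ifs <;> norm_num)
  have hz := (integral_eq_zero_iff_of_nonneg
    (fun θ => Finset.sum_nonneg fun a _ => Finset.sum_nonneg fun b _ => hterm θ a b)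
    (integrable_pair_integrand p μ SA SB _)).1 h
  have hconst : ∫ _ : unitInterval, 2 * (p * ((T : ℝ) + 1)) ∂μ = 2 * (p * (T + 1)) := by simp
  rw [← hconst]
  refine integral_mono_ae (integrable_pair_integrand p μ SA SB _) (integrable_const _) ?_
  filter_upwards [hz] with θ hθ
  rw [← sum_left_sumBits]
  refine Finset.sum_le_sum fun a _ => Finset.sum_le_sum fun b _ => ?_
  have hs : 0 ≤ sumBits a + sumBits b := add_nonneg (sumBits_nonneg a) (sumBits_nonneg b)
  by_cases hE : Explores SA SB a b
  · have h1 := (Finset.sum_eq_zero_iff_of_nonneg fun a _ =>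
      Finset.sum_nonneg fun b _ => hterm θ a b).1 hθ a (Finset.mem_univ a)
    have h2 := (Finset.sum_eq_zero_iff_of_nonneg fun b _ => hterm θ a b).1 h1 b (Finset.mem_univ b)
    rw [if_pos hE, mul_one] at h2
    rw [h2, zero_mul]
    exact mul_nonneg (mul_nonneg (pathWeight_nonneg (fun _ _ => hp.1) (fun _ _ => hp.2) a)
      (pathWeight_nonneg (fun _ _ => hp.1) (fun _ _ => hp.2) b)) hs
  · rw [pathProb_of_not_explores hE]

theorem totalReward_le_of_exploreProb_nonpos {T : ℕ} {p : ℝ} (hp : p ∈ Set.Icc (0 : ℝ) 1)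
    {μ : Measure unitInterval} [IsProbabilityMeasure μ] {σA σB : PMF (Strategy T)}
    (h : exploreProb p μ σA σB ≤ 0) : totalReward p μ σA σB ≤ 2 * (p * (T + 1)) := by
  refine mixedExp_le σA fun SA hA => mixedExp_le σB fun SB hB => pairExp_le_of_not_explores hp ?_
  have h1 := eq_zero_of_mixedExp_nonpos
    (fun SA => mixedExp_nonneg σB fun SB => pairExp_explores_nonneg hp μ SA SB) h hA
  exact eq_zero_of_mixedExp_nonpos (fun SB => pairExp_explores_nonneg hp μ SA SB) h1.le hB

theorem totalReward_pure {T : ℕ} (p : ℝ) (μ : Measure unitInterval) (SA SB : Strategy T) :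
    totalReward p μ (PMF.pure SA) (PMF.pure SB)
      = pairExp p μ SA SB fun a b => sumBits a + sumBits b := by
  rw [totalReward, mixedExp_pure, mixedExp_pure]

/-- A mixed pair averages over the finitely many pure pairs, so a best pure pair is optimal. -/
theorem exists_coopOptimal {T : ℕ} (p : ℝ) (μ : Measure unitInterval) :
    ∃ σA σB : PMF (Strategy T), CoopOptimal p μ σA σB := by
  have : Nonempty (Strategy T) := ⟨fun _ _ _ => Arm.L⟩
  obtain ⟨⟨SA, SB⟩, h⟩ := Finite.exists_max fun x : Strategy T × Strategy T =>
    pairExp p μ x.1 x.2 fun a b => sumBits a + sumBits b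
  refine ⟨PMF.pure SA, PMF.pure SB, fun τA τB => ?_⟩
  rw [totalReward_pure]
  exact mixedExp_le τA fun SA' _ => mixedExp_le τB fun SB' _ => h (SA', SB')

theorem exploreProb_pos_of_pairExp_gt {T : ℕ} {p : ℝ} (hp : p ∈ Set.Icc (0 : ℝ) 1)
    {μ : Measure unitInterval} [IsProbabilityMeasure μ] {SA SB : Strategy T}
    (h : 2 * (p * (T + 1)) < pairExp p μ SA SB fun a b => sumBits a + sumBits b)
    {σA σB : PMF (Strategy T)} (hσ : CoopOptimal p μ σA σB) : 0 < exploreProb p μ σA σB := by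
  by_contra hc
  have h1 := totalReward_le_of_exploreProb_nonpos hp (not_lt.1 hc)
  have h2 := hσ (PMF.pure SA) (PMF.pure SB)
  rw [totalReward_pure] at h2
  linarith

/-! ### A partner who learns from Alice's actions -/

open Classical in
/-- Bob pulls right only in round `u + 1`, if Alice pulled right in round `u` and before. -/
def imitateOnce {T : ℕ} (u : Fin (T + 1)) : (t : Fin (T + 1)) → (Fin t.val → Arm) → Arm :=
  fun t h => if ∃ v : Fin t.val, v.val = u.val ∧ t.val = u.val + 1 ∧ h v = Arm.R ∧
    ∃ s : Fin t.val, s.val < u.val ∧ h s = Arm.R then Arm.R else Arm.L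

theorem sum_response_imitateOnce {T : ℕ} (S : SoloStrategy T) {u : Fin (T + 1)} (hu : u.val < T)
    (a : Bits T) : (∑ t, if response S (imitateOnce u) a t = Arm.R then (1 : ℝ) else 0)
      = rightInd S u a * (if ExploredBefore S u.val a then 1 else 0) := by
  classical
  have hiff : ∀ t, response S (imitateOnce u) a t = Arm.R ↔
      t.val = u.val + 1 ∧ soloPlay S a u = Arm.R ∧ ExploredBefore S u.val a := by
    intro t
    unfold response imitateOnce
    rw [ite_eq_left_iff]
    simp only [reduceCtorEq, imp_false, not_not]
    constructor
    · rintro ⟨v, hv, ht, hR, s, hs, hsR⟩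
      exact ⟨ht, by rwa [show u = v.castLE t.isLt.le from Fin.ext hv.symm], s.castLE t.isLt.le,
        hs, hsR⟩
    · rintro ⟨ht, hR, s, hs, hsR⟩
      exact ⟨⟨u.val, by omega⟩, rfl, ht, hR, ⟨s.val, by omega⟩, hs, hsR⟩
  rw [Finset.sum_eq_single (⟨u.val + 1, by omega⟩ : Fin (T + 1))]
  · simp only [hiff, rightInd, true_and]
    split_ifs <;> simp_all
  · intro t _ ht
    rw [if_neg]
    rw [hiff]
    exact fun h => ht (Fin.ext h.1)
  · simp

/-- At the index a single player is indifferent, but a partner who watches gains. -/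
theorem exists_pairExp_gt_at_index {T : ℕ} {μ : Measure unitInterval} [IsProbabilityMeasure μ]
    {M : ℝ} (hM : ∀ᵐ θ : unitInterval ∂μ, (θ : ℝ) ≤ M) (h0 : 0 < finiteIndex μ T)
    (h1 : finiteIndex μ T < 1)
    (hgM : M - finiteIndex μ T < finiteIndex μ T - ∫ θ : unitInterval, (θ : ℝ) ∂μ)
    (hm : ∫ θ : unitInterval, (θ : ℝ) ∂μ < finiteIndex μ T) :
    ∃ SA SB : Strategy T, 2 * (finiteIndex μ T * (T + 1))
      < pairExp (finiteIndex μ T) μ SA SB fun a b => sumBits a + sumBits b := by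
  obtain ⟨S, hS, a, t, hat⟩ := exists_exploring_at_index h0 h1
  set g := finiteIndex μ T
  have hg : g ∈ Set.Icc (0 : ℝ) 1 := ⟨h0.le, h1.le⟩
  have hpos : 0 < exploreWeight g S (T + 1) := exploreWeight_pos ⟨h0, h1⟩ hat
  -- If only the last round could have positive later gain, that gain would be less than the loss `g
  -- - m` per exploration, and `S` would fall below always left. Having `u < T` leaves Bob the round
  -- `u + 1`.
  obtain ⟨u, hu, hgain⟩ : ∃ u : Fin (T + 1), u.val < T ∧ 0 < laterGain g μ S u := by
    by_contra hc
    push Not at hc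
    have hS' := hS
    rw [soloReward_eq_explore, Fin.sum_univ_castSucc] at hS'
    have hle : ∑ u : Fin T, laterGain g μ S u.castSucc ≤ 0 :=
      Finset.sum_nonpos fun u _ => hc u.castSucc u.isLt
    have hlast := laterGain_le (S := S) hg hM (Fin.last T)
    have hmax : max (M - g) 0 < g - ∫ θ : unitInterval, (θ : ℝ) ∂μ :=
      max_lt hgM (by linarith)
    have := mul_lt_mul_of_pos_right hmax hpos
    linarith
  refine ⟨ignoringPartner S, watching (imitateOnce u), ?_⟩
  rw [pairExp_watching]
  simp only [sum_response_imitateOnce S hu]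
  unfold laterGain at hgain
  linarith

/-- Alice alone beats always left, and Bob stays left. -/
theorem exists_pairExp_gt_below_index {T : ℕ} {p : ℝ} {μ : Measure unitInterval}
    [IsProbabilityMeasure μ] (hp : p ∈ Set.Icc (0 : ℝ) 1) (h : p < finiteIndex μ T) :
    ∃ SA SB : Strategy T,
      2 * (p * (T + 1)) < pairExp p μ SA SB fun a b => sumBits a + sumBits b := by
  obtain ⟨S, hS⟩ := exists_soloReward_gt hp h
  refine ⟨ignoringPartner S, watching fun _ _ => Arm.L, ?_⟩
  rw [pairExp_watching]
  simp only [response, reduceCtorEq, if_false, Finset.sum_const_zero]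
  simp only [gain, soloExp, mul_zero, Finset.sum_const_zero, integral_zero]
  linarith

end

theorem theorem8 (μ : MeasureTheory.Measure unitInterval)
    [MeasureTheory.IsProbabilityMeasure μ]
    (hμ : ∀ x : unitInterval, μ ≠ MeasureTheory.Measure.dirac x) :
    ∃ T₀ : ℕ, ∀ T : ℕ, T₀ ≤ T →
      ∃ δ : ℝ, 0 < δ ∧
        ∀ p : ℝ, p ∈ Set.Icc (0 : ℝ) 1 → p < finiteIndex μ T + δ →
          (∃ σA σB : PMF (Strategy T), CoopOptimal p μ σA σB) ∧
          ∀ σA σB : PMF (Strategy T), CoopOptimal p μ σA σB → 0 < exploreProb p μ σA σB := by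
  obtain ⟨M, p₀, hM, hp₀, hp₀M, hM1, hμp₀, hMm⟩ := exists_threshold hμ
  have hm1 : ∫ θ : unitInterval, (θ : ℝ) ∂μ < 1 := by linarith
  obtain ⟨T₀, hT₀⟩ := exists_forall_le_finiteIndex hp₀ hμp₀ hm1
  refine ⟨T₀, fun T hT => ?_⟩
  have hg := hT₀ T hT
  obtain ⟨SA, SB, hgt⟩ := exists_pairExp_gt_at_index hM (hp₀.trans_le hg)
    (finiteIndex_lt_one T hm1) (by linarith) (by linarith)
  have hcont : ∀ᶠ p in nhds (finiteIndex μ T),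
      2 * (p * ((T : ℝ) + 1)) < pairExp p μ SA SB fun a b => sumBits a + sumBits b :=
    (continuous_const.mul (continuous_id.mul continuous_const)).continuousAt.eventually_lt
      (continuous_pairExp μ SA SB _).continuousAt hgt
  obtain ⟨δ, hδ, hball⟩ := Metric.eventually_nhds_iff.1 hcont
  refine ⟨δ, hδ, fun p hp hpδ => ⟨exists_coopOptimal p μ, fun σA σB hσ => ?_⟩⟩
  -- Continuity controls only a neighbourhood of the index, so smaller `p` need the single player
  -- strategy instead.
  rcases lt_or_ge p (finiteIndex μ T) with hlt | hge
  · obtain ⟨SA', SB', h⟩ := exists_pairExp_gt_below_index hp hlt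
    exact exploreProb_pos_of_pairExp_gt hp h hσ
  · refine exploreProb_pos_of_pairExp_gt hp (hball ?_) hσ
    rw [Real.dist_eq, abs_of_nonneg (by linarith)]
    linarith
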